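/- Let $m_1,m_2>0$, $\alpha>1$, $\Omega>0$, $\theta>0$. Let $N_1,N_2,I$ be independent real random variables such that $N_j^2$ ($j=1,2$) has density $$\frac{m_j^{m_j}x^{m_j-1}}{\Omega^{m_j}\Gamma(m_j)}e^{-m_jx/\Omega},\qquad x>0$$ (squared Nakagami-$m_j$ fading with mean square value $\Omega$), and $I$ has the inverse-gamma density $$\frac{\theta^{\alpha}}{\Gamma(\alpha)\,y^{\alpha+1}}e^{-\theta/y},\qquad y>0.$$ Put $\overline\gamma=\Omega^2\theta$ (so $\overline\gamma=\theta$ when $\Omega=1$), $\tilde\gamma=m_1m_2/\overline\gamma$ and $\mathcal S_2=\frac1{\Gamma(m_1)\Gamma(m_2)\Gamma(\alpha)}$. Then the single-shadowing SNR $\gamma^s=(N_1N_2)^2I$ is absolutely continuous, with a density $f$ that vanishes on $(-\infty,0]$ and is positive on $(0,\infty)$, where $$f(\gamma)=\mathcal S_2\,\gamma^{-1}\,G^{2,1}_{1,2}\!\left(\tilde\gamma\gamma\,\Big|\,{1-\alpha\atop m_1,m_2}\right)=\Gamma(\alpha+m_1)\Gamma(\alpha+m_2)\,\mathcal S_2\,\tilde\gamma^{m_1}\gamma^{m_1-1}\,U(\alpha+m_1;\,m_1-m_2+1;\,\tilde\gamma\gamma).$$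 Moreover $\gamma^s$ is integrable with mean $$\mathbb E[\gamma^s]=\frac{\overline\gamma}{\alpha-1}.$$ Here, for $z>0$, the Meijer $G$-function is the Mellin–Barnes integral $$G^{2,1}_{1,2}\!\left(z\,\Big|\,{1-\alpha\atop m_1,m_2}\right)=\frac1{2\pi i}\int_{c-i\infty}^{c+i\infty}\Gamma(m_1-s)\Gamma(m_2-s)\Gamma(\alpha+s)\,z^s\,ds,$$ which converges absolutely for every $c\in(-\alpha,\min(m_1,m_2))$ to a value that does not depend on $c$, and $U$ is Tricomi's confluent hypergeometric function $$U(a;b;z)=\frac1{\Gamma(a)}\int_0^\infty e^{-zt}t^{a-1}(1+t)^{b-a-1}\,dt\qquad(a,z>0).$$ -/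

import Mathlib

open MeasureTheory ProbabilityTheory Set

noncomputable section

/-- Density of the squared envelope of a Nakagami-`m` fading coefficient with shape `m` and
mean square value `Ω`. -/
def nakagamiSqPDF (m Ω x : ℝ) : ℝ :=
  if 0 < x then m ^ m * x ^ (m - 1) / (Ω ^ m * Real.Gamma m) * Real.exp (-(m * x / Ω)) else 0

/-- Density of the inverse-gamma distribution with shape `α` and scale `θ`. -/
def invGammaPDF (α θ y : ℝ) : ℝ :=
  if 0 < y then θ ^ α / (Real.Gamma α * y ^ (α + 1)) * Real.exp (-(θ / y)) else 0

/-- The measure on the real line with Lebesgue density `f`. -/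
def densityMeasure (f : ℝ → ℝ) : Measure ℝ :=
  volume.withDensity (fun x => ENNReal.ofReal (f x))

/-- The integrand of the Mellin-Barnes integral of the Meijer function `G^{m,n}_{p,q}`, with
upper parameters `a` and lower parameters `b`.  (`Complex.Gamma` vanishes at its poles in Lean, so
that dividing by it gives the correct value `0` of the reciprocal Gamma function there.) -/
def meijerIntegrand (m n : ℕ) {p q : ℕ} (a : Fin p → ℂ) (b : Fin q → ℂ) (z s : ℂ) : ℂ :=
  ((∏ j with j.val < m, Complex.Gamma (b j - s)) *
      ∏ j with j.val < n, Complex.Gamma (1 - a j + s)) /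
    ((∏ j with m ≤ j.val, Complex.Gamma (1 - b j + s)) *
      ∏ j with n ≤ j.val, Complex.Gamma (a j - s)) * z ^ s

/-- The vertical line `Re s = c` separates the poles of the `Γ(b_j - s)`, `j ≤ m` (to its right),
from those of the `Γ(1 - a_j + s)`, `j ≤ n` (to its left). -/
def MeijerSeparates (m n : ℕ) {p q : ℕ} (a : Fin p → ℂ) (b : Fin q → ℂ) (c : ℝ) : Prop :=
  (∀ j, j.val < m → c < (b j).re) ∧ (∀ j, j.val < n → (a j).re - 1 < c)

/-- The Mellin-Barnes integral `(1 / 2πi) ∫ ... ds` along the line `Re s = c`, `s = c + i t`. -/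
def mellinBarnes (m n : ℕ) {p q : ℕ} (a : Fin p → ℂ) (b : Fin q → ℂ) (c : ℝ) (z : ℂ) : ℂ :=
  (2 * (Real.pi : ℂ))⁻¹ * ∫ t : ℝ, meijerIntegrand m n a b z ((c : ℂ) + (t : ℂ) * Complex.I)

open Classical in
/-- The Meijer function `G^{m,n}_{p,q}(z | a; b)` for parameters admitting a vertical line that
separates the two families of poles (the value is the junk `0` if there is no such line). -/
def meijerG (m n : ℕ) {p q : ℕ} (a : Fin p → ℂ) (b : Fin q → ℂ) (z : ℂ) : ℂ :=
  if h : ∃ c : ℝ, MeijerSeparates m n a b c then mellinBarnes m n a b h.choose z else 0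

/-- Tricomi's confluent hypergeometric function `U(a; b; z)`, for `0 < a` and `0 < z`. -/
def tricomiU (a b z : ℝ) : ℝ :=
  (Real.Gamma a)⁻¹ *
    ∫ t in Ioi (0 : ℝ), Real.exp (-(z * t)) * t ^ (a - 1) * (1 + t) ^ (b - a - 1)

end

/-!
Call `(f ⋆ g)(z) = ∫₀^∞ f(z / y) g(y) dy / y` the multiplicative convolution.  With respect to the
Haar measure `dx / x` of `(0, ∞)`, a product of independent positive random variables has the
convolution of the densities as its density, and the Mellin transform turns `⋆` into a product.  Up
to scaling, the densities of `N_j²` and of `I` are `x ^ m_j e⁻ˣ` and `x ^ (-α) e ^ (-1 / x)`, with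
Mellin transforms `Γ(m_j + s)` and `Γ(α - s)`.  The threefold convolution therefore has Mellin
transform `Γ(m₁ + s) Γ(m₂ + s) Γ(α - s)`, and Mellin inversion is the Meijer `G` formula, on every
admissible line at once.  Carrying out the inner convolution gives `v ^ m₂ (1 + v) ^ (-(α + m₂))`
(the beta prime law), after which the outer one is the integral defining Tricomi's function.  The
mean is the value of the Mellin transform at `s = 1`.
-/

/-! ### Vertical lines and Mellin–Barnes integrals -/

theorem norm_complexGamma_le {s : ℂ} (hs : 0 < s.re) : ‖Complex.Gamma s‖ ≤ Real.Gamma s.re := by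
  rw [Complex.Gamma_eq_integral hs, Real.Gamma_eq_integral hs, Complex.GammaIntegral]
  refine (norm_integral_le_integral_norm _).trans_eq ?_
  refine setIntegral_congr_fun measurableSet_Ioi fun x hx => ?_
  rw [mem_Ioi] at hx
  simp only [norm_mul, Complex.norm_real, Real.norm_eq_abs, abs_of_pos (Real.exp_pos _),
    Complex.norm_cpow_eq_rpow_re_of_pos hx, Complex.sub_re, Complex.one_re]

theorem norm_complexGamma_le_div_sq {s : ℂ} (hs : 0 < s.re) :
    ‖Complex.Gamma s‖ ≤ Real.Gamma (s.re + 2) / ‖s‖ ^ 2 := by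
  have hs_ne : s ≠ 0 := fun h => hs.ne' (by rw [h, Complex.zero_re])
  have hs1_ne : s + 1 ≠ 0 := fun h => by
    have := congrArg Complex.re h
    rw [Complex.add_re, Complex.one_re, Complex.zero_re] at this
    linarith
  have hrec : Complex.Gamma (s + 2) = s * (s + 1) * Complex.Gamma s := by
    rw [show s + 2 = s + 1 + 1 by ring, Complex.Gamma_add_one _ hs1_ne,
      Complex.Gamma_add_one _ hs_ne]
    ring
  have hnorm : ‖s‖ ≤ ‖s + 1‖ := by
    refine Real.sqrt_le_sqrt ?_
    simp only [Complex.normSq_apply, Complex.add_re, Complex.add_im, Complex.one_re,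
      Complex.one_im]
    nlinarith
  rw [le_div_iff₀ (by positivity)]
  calc ‖Complex.Gamma s‖ * ‖s‖ ^ 2 = ‖s‖ * ‖s‖ * ‖Complex.Gamma s‖ := by ring
    _ ≤ ‖s‖ * ‖s + 1‖ * ‖Complex.Gamma s‖ := by gcongr
    _ = ‖Complex.Gamma (s + 2)‖ := by rw [hrec, norm_mul, norm_mul]
    _ ≤ Real.Gamma (s.re + 2) := by
        simpa using norm_complexGamma_le (s := s + 2) (by simpa using by linarith)

theorem continuous_complexGamma_vertical {a : ℝ} (ha : 0 < a) :
    Continuous fun t : ℝ => Complex.Gamma (a + t * Complex.I) := by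
  refine continuous_iff_continuousAt.2 fun t => ?_
  have hΓ : ContinuousAt Complex.Gamma (a + t * Complex.I) := by
    refine (Complex.differentiableAt_Gamma _ fun n hn => ?_).continuousAt
    have hre : a = -n := by simpa using congrArg Complex.re hn
    linarith [n.cast_nonneg (α := ℝ)]
  exact ContinuousAt.comp (f := fun t : ℝ => (a : ℂ) + t * Complex.I) hΓ (by fun_prop)

theorem verticalIntegrable_complexGamma {a : ℝ} (ha : 0 < a) :
    Complex.VerticalIntegrable Complex.Gamma a := by
  have hbound : Integrable fun t : ℝ => Real.Gamma (a + 2) / (a ^ 2 + t ^ 2) := by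
    refine ((integrable_inv_one_add_sq.comp_div ha.ne').const_mul
      (Real.Gamma (a + 2) / a ^ 2)).congr (.of_forall fun t => ?_)
    simp only
    field_simp
  refine hbound.mono' (continuous_complexGamma_vertical ha).aestronglyMeasurable
    (.of_forall fun t => ?_)
  have hre : (a + t * Complex.I).re = a := by simp
  have hsq : ‖(a + t * Complex.I : ℂ)‖ ^ 2 = a ^ 2 + t ^ 2 := by
    rw [Complex.sq_norm, Complex.normSq_add_mul_I]
  simpa only [hre, hsq] using norm_complexGamma_le_div_sq (s := a + t * Complex.I) (by rwa [hre])

theorem meijerIntegrand_eq_mul_cpow (m n : ℕ) {p q : ℕ} (a : Fin p → ℂ) (b : Fin q → ℂ) (z s : ℂ) :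
    meijerIntegrand m n a b z s = meijerIntegrand m n a b 1 s * z ^ s := by
  simp only [meijerIntegrand, Complex.one_cpow, mul_one]

theorem verticalIntegrable_meijerIntegrand {m n p q : ℕ} {a : Fin p → ℂ} {b : Fin q → ℂ} {c z : ℝ}
    (hz : 0 < z) (h : Complex.VerticalIntegrable (meijerIntegrand m n a b 1) c) :
    Complex.VerticalIntegrable (meijerIntegrand m n a b z) c := by
  have hpow : Continuous fun t : ℝ => (z : ℂ) ^ ((c : ℂ) + t * Complex.I) :=
    Continuous.const_cpow (by fun_prop) (Or.inl (by exact_mod_cast hz.ne'))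
  refine (h.mul_bdd (c := z ^ c) hpow.aestronglyMeasurable (.of_forall fun t => ?_)).congr
    (.of_forall fun t => (meijerIntegrand_eq_mul_cpow m n a b z _).symm)
  rw [Complex.norm_cpow_eq_rpow_re_of_pos hz]
  simp

theorem mellinBarnes_eq_of_hasMellin {m n p q : ℕ} {a : Fin p → ℂ} {b : Fin q → ℂ} {c z : ℝ}
    {f : ℝ → ℂ} (hz : 0 < z) (hf : ContinuousAt f z)
    (hint : Complex.VerticalIntegrable (meijerIntegrand m n a b 1) c)
    (hmellin : ∀ s : ℂ, s.re = -c → HasMellin f s (meijerIntegrand m n a b 1 (-s))) :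
    mellinBarnes m n a b c z = f z := by
  have hline : ∀ t : ℝ, mellin f ((-c : ℝ) + t * Complex.I) =
      meijerIntegrand m n a b 1 (c + (-t : ℝ) * Complex.I) := fun t => by
    rw [(hmellin _ (by simp)).2]
    congr 1
    push_cast
    ring
  have hvert : Complex.VerticalIntegrable (mellin f) (-c) := by
    simpa only [Complex.VerticalIntegrable, hline] using hint.comp_neg
  have hkernel : ∀ t : ℝ, (z : ℂ) ^ (-(((-c : ℝ) : ℂ) + t * Complex.I)) •
      mellin f ((-c : ℝ) + t * Complex.I) =
        meijerIntegrand m n a b z (c + (-t : ℝ) * Complex.I) := fun t => by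
    rw [hline, meijerIntegrand_eq_mul_cpow m n a b z, smul_eq_mul, mul_comm]
    congr 2
    push_cast
    ring
  rw [← mellinInv_mellin_eq (-c) f hz (hmellin _ (by simp)).1 hvert hf, mellinInv, mellinBarnes]
  simp_rw [hkernel]
  rw [integral_neg_eq_self (fun t : ℝ => meijerIntegrand m n a b z (c + t * Complex.I)),
    Complex.real_smul]
  push_cast
  rw [one_div]

theorem meijerIntegrand_two_one (m₁ m₂ α : ℝ) (z s : ℂ) :
    meijerIntegrand 2 1 ![1 - (α : ℂ)] ![(m₁ : ℂ), (m₂ : ℂ)] z s =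
      Complex.Gamma (m₁ - s) * Complex.Gamma (m₂ - s) * Complex.Gamma (α + s) * z ^ s := by
  simp [meijerIntegrand, Finset.prod_filter, Fin.prod_univ_two]

theorem meijerSeparates_two_one_iff {m₁ m₂ α c : ℝ} :
    MeijerSeparates 2 1 ![1 - (α : ℂ)] ![(m₁ : ℂ), (m₂ : ℂ)] c ↔ -α < c ∧ c < m₁ ∧ c < m₂ := by
  simp [MeijerSeparates, Fin.forall_fin_two, and_comm, and_assoc]

theorem verticalIntegrable_meijerIntegrand_two_one {m₁ m₂ α c : ℝ}
    (hc : MeijerSeparates 2 1 ![1 - (α : ℂ)] ![(m₁ : ℂ), (m₂ : ℂ)] c) :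
    Complex.VerticalIntegrable
      (meijerIntegrand 2 1 ![1 - (α : ℂ)] ![(m₁ : ℂ), (m₂ : ℂ)] 1) c := by
  obtain ⟨hα, h₁, h₂⟩ := meijerSeparates_two_one_iff.1 hc
  have hα' : 0 < α + c := by linarith
  have hcont : ∀ {b : ℝ}, 0 < b → Continuous fun t : ℝ => Complex.Gamma (b - t * Complex.I) :=
    fun hb => ((continuous_complexGamma_vertical hb).comp continuous_neg).congr fun t => by
      simp [sub_eq_add_neg]
  have hbound : ∀ {b : ℝ}, 0 < b → ∀ t : ℝ,
      ‖Complex.Gamma (b - t * Complex.I)‖ ≤ Real.Gamma b := fun {b} hb t => by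
    simpa using norm_complexGamma_le (s := b - t * Complex.I) (by simpa using hb)
  refine (((verticalIntegrable_complexGamma hα').bdd_mul
    (hcont (sub_pos.2 h₂)).aestronglyMeasurable (.of_forall (hbound (sub_pos.2 h₂)))).bdd_mul
    (hcont (sub_pos.2 h₁)).aestronglyMeasurable (.of_forall (hbound (sub_pos.2 h₁)))).congr
    (.of_forall fun t => ?_)
  simp only [meijerIntegrand_two_one, Complex.one_cpow, mul_one]
  push_cast
  ring_nf

/-! ### Multiplicative convolution -/

section MulConvolution

variable {𝕜 : Type*} [RCLike 𝕜]

/-- The convolution of two functions on the multiplicative group `(0, ∞)` with respect to its Haar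
measure `dy / y`.  It governs densities of products of independent positive random variables, and
the Mellin transform turns it into a product. -/
noncomputable def mulConvolution (f g : ℝ → 𝕜) (z : ℝ) : 𝕜 :=
  ∫ y in Ioi (0 : ℝ), y⁻¹ • (f (z / y) * g y)

theorem mulConvolution_nonneg {f g : ℝ → ℝ} (hf : ∀ x, 0 < x → 0 ≤ f x)
    (hg : ∀ x, 0 < x → 0 ≤ g x) {z : ℝ} (hz : 0 < z) : 0 ≤ mulConvolution f g z :=
  setIntegral_nonneg measurableSet_Ioi fun y (hy : 0 < y) =>
    smul_nonneg (inv_pos.2 hy).le (mul_nonneg (hf _ (div_pos hz hy)) (hg y hy))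

theorem measurable_mulConvolution {f g : ℝ → 𝕜} (hf : Measurable f) (hg : Measurable g) :
    Measurable (mulConvolution f g) :=
  (Measurable.stronglyMeasurable
    (by fun_prop : Measurable fun p : ℝ × ℝ =>
      p.2⁻¹ • (f (p.1 / p.2) * g p.2))).integral_prod_right.measurable

theorem mulConvolution_eq_integral_comp_mul (f g : ℝ → 𝕜) (z : ℝ) {r : ℝ} (hr : 0 < r) :
    mulConvolution f g z = ∫ t in Ioi (0 : ℝ), t⁻¹ • (f (z / (r * t)) * g (r * t)) := by
  have hsub := integral_comp_mul_left_Ioi (fun y : ℝ => y⁻¹ • (f (z / y) * g y)) 0 hr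
  rw [mul_zero, ← inv_smul_eq_iff₀ (inv_ne_zero hr.ne'), inv_inv, ← integral_smul] at hsub
  rw [mulConvolution, ← hsub]
  simp only [mul_inv, smul_smul, mul_inv_cancel_left₀ hr.ne']

theorem integrableOn_comp_div {f : ℝ → 𝕜} {y : ℝ} (hy : 0 < y) (hf : IntegrableOn f (Ioi 0)) :
    IntegrableOn (fun z => f (z / y)) (Ioi 0) := by
  simpa only [div_eq_inv_mul, mul_zero] using
    (integrableOn_Ioi_comp_mul_left_iff f 0 (inv_pos.2 hy)).2 (by rwa [mul_zero])

theorem integral_comp_div_Ioi {E : Type*} [NormedAddCommGroup E] [NormedSpace ℝ E] (f : ℝ → E)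
    {y : ℝ} (hy : 0 < y) : ∫ z in Ioi 0, f (z / y) = y • ∫ z in Ioi 0, f z := by
  simpa only [div_eq_inv_mul, mul_zero, inv_inv] using
    integral_comp_mul_left_Ioi f 0 (inv_pos.2 hy)

theorem integrable_mulConvolution_integrand {f g : ℝ → 𝕜} (hfm : Measurable f) (hgm : Measurable g)
    (hf : IntegrableOn f (Ioi 0)) (hg : IntegrableOn g (Ioi 0)) :
    Integrable (fun p : ℝ × ℝ => p.1⁻¹ • (f (p.2 / p.1) * g p.1))
      ((volume.restrict (Ioi 0)).prod (volume.restrict (Ioi 0))) := by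
  have hmeas : Measurable fun p : ℝ × ℝ => p.1⁻¹ • (f (p.2 / p.1) * g p.1) := by fun_prop
  refine (integrable_prod_iff hmeas.aestronglyMeasurable).2 ⟨?_, ?_⟩
  · filter_upwards [ae_restrict_mem measurableSet_Ioi] with y hy
    exact ((integrableOn_comp_div hy hf).mul_const _).smul y⁻¹
  · refine IntegrableOn.congr_fun (hg.norm.const_mul (∫ z in Ioi 0, ‖f z‖))
      (fun y (hy : 0 < y) => ?_) measurableSet_Ioi
    simp only [norm_smul, norm_mul, norm_inv, Real.norm_eq_abs, abs_of_pos hy, integral_const_mul,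
      integral_mul_const, integral_comp_div_Ioi (fun z => ‖f z‖) hy, smul_eq_mul]
    field_simp

theorem integrableOn_mulConvolution {f g : ℝ → 𝕜} (hfm : Measurable f) (hgm : Measurable g)
    (hf : IntegrableOn f (Ioi 0)) (hg : IntegrableOn g (Ioi 0)) :
    IntegrableOn (mulConvolution f g) (Ioi 0) :=
  (integrable_mulConvolution_integrand hfm hgm hf hg).integral_prod_right

theorem integral_mulConvolution {f g : ℝ → 𝕜} (hfm : Measurable f) (hgm : Measurable g)
    (hf : IntegrableOn f (Ioi 0)) (hg : IntegrableOn g (Ioi 0)) :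
    ∫ z in Ioi 0, mulConvolution f g z = (∫ z in Ioi 0, f z) * ∫ z in Ioi 0, g z := by
  calc ∫ z in Ioi 0, mulConvolution f g z
      = ∫ y in Ioi (0 : ℝ), ∫ z in Ioi (0 : ℝ), y⁻¹ • (f (z / y) * g y) :=
        (integral_integral_swap (integrable_mulConvolution_integrand hfm hgm hf hg)).symm
    _ = ∫ y in Ioi (0 : ℝ), (∫ z in Ioi 0, f z) * g y := by
        refine setIntegral_congr_fun measurableSet_Ioi fun y (hy : 0 < y) => ?_
        simp only [integral_smul, integral_mul_const, integral_comp_div_Ioi f hy, smul_mul_assoc,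
          inv_smul_smul₀ hy.ne']
    _ = (∫ z in Ioi 0, f z) * ∫ z in Ioi 0, g z := integral_const_mul _ _

theorem mulConvolution_mul_of_multiplicative {χ : ℝ → 𝕜}
    (hχ : ∀ x y, 0 < x → 0 < y → χ (x * y) = χ x * χ y) (f g : ℝ → 𝕜) {z : ℝ} (hz : 0 < z) :
    mulConvolution (fun x => χ x * f x) (fun x => χ x * g x) z = χ z * mulConvolution f g z := by
  rw [mulConvolution, mulConvolution, ← integral_const_mul]
  refine setIntegral_congr_fun measurableSet_Ioi fun y (hy : 0 < y) => ?_
  have hsplit : χ z = χ (z / y) * χ y := by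
    rw [← hχ _ _ (div_pos hz hy) hy, div_mul_cancel₀ z hy.ne']
  simp only [hsplit, RCLike.real_smul_eq_coe_mul]
  ring

theorem mulConvolution_const_mul_comp_mul (c d : 𝕜) (f g : ℝ → 𝕜) (k : ℝ) {l : ℝ} (hl : 0 < l)
    (z : ℝ) : mulConvolution (fun x => c * f (k * x)) (fun x => d * g (l * x)) z =
      c * d * mulConvolution f g (k * l * z) := by
  rw [mulConvolution_eq_integral_comp_mul f g _ hl, mulConvolution, ← integral_const_mul]
  refine setIntegral_congr_fun measurableSet_Ioi fun y (hy : 0 < y) => ?_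
  have hquot : k * l * z / (l * y) = k * (z / y) := by field_simp
  simp only [hquot, RCLike.real_smul_eq_coe_mul]
  ring

end MulConvolution

theorem mulConvolution_ofReal (f g : ℝ → ℝ) :
    mulConvolution (fun x => (f x : ℂ)) (fun x => (g x : ℂ)) =
      fun z => ((mulConvolution f g z : ℝ) : ℂ) := by
  ext z
  simp only [mulConvolution, ← integral_complex_ofReal, smul_eq_mul, Complex.real_smul,
    Complex.ofReal_mul]

theorem hasMellin_mulConvolution {f g : ℝ → ℂ} {s M N : ℂ} (hfm : Measurable f)
    (hgm : Measurable g) (hf : HasMellin f s M) (hg : HasMellin g s N) :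
    HasMellin (mulConvolution f g) s (M * N) := by
  have hfm' : Measurable fun x : ℝ => (x : ℂ) ^ (s - 1) * f x := by fun_prop
  have hgm' : Measurable fun x : ℝ => (x : ℂ) ^ (s - 1) * g x := by fun_prop
  have hweight : EqOn (mulConvolution (fun x => (x : ℂ) ^ (s - 1) * f x)
      (fun x => (x : ℂ) ^ (s - 1) * g x))
      (fun z => (z : ℂ) ^ (s - 1) • mulConvolution f g z) (Ioi 0) :=
    fun z hz => mulConvolution_mul_of_multiplicative (χ := fun x : ℝ => (x : ℂ) ^ (s - 1))
      (fun x y hx hy => by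
        rw [Complex.ofReal_mul, Complex.mul_cpow_ofReal_nonneg hx.le hy.le]) f g hz
  constructor
  · exact (integrableOn_mulConvolution hfm' hgm' hf.1 hg.1).congr_fun hweight measurableSet_Ioi
  · rw [mellin, ← setIntegral_congr_fun measurableSet_Ioi hweight,
      integral_mulConvolution hfm' hgm' hf.1 hg.1, ← hf.2, ← hg.2]
    rfl

/-! ### Gamma kernels and Tricomi's function -/

/-- The function `x ↦ xᵃ e⁻ˣ`, whose Mellin transform is the shifted Gamma function; up to a
constant it is the density of a Gamma(`a`) variable with respect to `dx / x`. -/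
noncomputable def gammaKernel (a x : ℝ) : ℝ := x ^ a * Real.exp (-x)

@[fun_prop]
theorem measurable_gammaKernel (a : ℝ) : Measurable (gammaKernel a) := by
  unfold gammaKernel
  fun_prop

theorem gammaKernel_nonneg (a : ℝ) {x : ℝ} (hx : 0 ≤ x) : 0 ≤ gammaKernel a x := by
  unfold gammaKernel
  positivity

theorem hasMellin_gammaKernel {a : ℝ} {s : ℂ} (hs : 0 < a + s.re) :
    HasMellin (fun x => (gammaKernel a x : ℂ)) s (Complex.Gamma (a + s)) := by
  have hre : 0 < (a + s).re := by simpa using hs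
  have hkernel : EqOn (fun x : ℝ => (Real.exp (-x) : ℂ) * (x : ℂ) ^ (a + s - 1))
      (fun x : ℝ => (x : ℂ) ^ (s - 1) • (gammaKernel a x : ℂ)) (Ioi 0) := by
    intro x (hx : 0 < x)
    simp only [gammaKernel, Complex.ofReal_mul, Complex.ofReal_cpow hx.le, smul_eq_mul]
    rw [add_sub_assoc, Complex.cpow_add _ _ (by exact_mod_cast hx.ne')]
    ring
  refine ⟨(Complex.GammaIntegral_convergent hre).congr_fun hkernel measurableSet_Ioi, ?_⟩
  rw [mellin, ← setIntegral_congr_fun measurableSet_Ioi hkernel, Complex.Gamma_eq_integral hre,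
    Complex.GammaIntegral]

theorem hasMellin_comp_inv {E : Type*} [NormedAddCommGroup E] [NormedSpace ℂ E] {f : ℝ → E} {s : ℂ}
    {M : E} (hf : HasMellin f (-s) M) : HasMellin (fun x => f x⁻¹) s M := by
  refine ⟨?_, by rw [mellin_comp_inv, hf.2]⟩
  simpa only [Real.rpow_neg_one] using
    (MellinConvergent.comp_rpow (f := f) (s := s) (a := -1) (by norm_num)).2
      (by simpa [div_neg] using hf.1)

theorem hasMellin_gammaKernel_inv {a : ℝ} {s : ℂ} (hs : s.re < a) :
    HasMellin (fun x => (gammaKernel a x⁻¹ : ℂ)) s (Complex.Gamma (a - s)) := by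
  simpa only [sub_eq_add_neg] using hasMellin_comp_inv (f := fun x => (gammaKernel a x : ℂ))
    (hasMellin_gammaKernel (s := -s) (by simpa using hs))

theorem mulConvolution_gammaKernel_inv_gammaKernel {a b v : ℝ} (hab : 0 < a + b) (hv : 0 < v) :
    mulConvolution (fun y => gammaKernel a y⁻¹) (gammaKernel b) v =
      Real.Gamma (a + b) * (v ^ b * (1 + v) ^ (-(a + b))) := by
  have hintegrand : EqOn (fun y => y⁻¹ • (gammaKernel a (v / y)⁻¹ * gammaKernel b y))
      (fun y => v ^ (-a) * (y ^ (a + b - 1) * Real.exp (-((1 + v) / v * y)))) (Ioi 0) := by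
    intro y (hy : 0 < y)
    have hexp : -((1 + v) / v * y) = -(y / v) + -y := by field_simp; ring
    simp only [gammaKernel, smul_eq_mul, inv_div, hexp, Real.exp_add, Real.div_rpow hy.le hv.le,
      Real.rpow_sub_one hy.ne', Real.rpow_add hy, Real.rpow_neg hv.le]
    ring
  rw [mulConvolution, setIntegral_congr_fun measurableSet_Ioi hintegrand, integral_const_mul,
    Real.integral_rpow_mul_exp_neg_mul_Ioi hab (by positivity), one_div_div,
    Real.div_rpow hv.le (by positivity), Real.rpow_add hv, Real.rpow_neg hv.le,
    Real.rpow_neg (by positivity)]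
  have := (Real.rpow_pos_of_pos hv a).ne'
  field_simp

/-- The unnormalised density, with respect to `dx / x`, of `Y₁ Y₂ / Z` for independent Gamma
variables `Y₁`, `Y₂`, `Z` with shapes `m₁`, `m₂`, `α`. -/
noncomputable def shadowingKernel (m₁ m₂ α : ℝ) : ℝ → ℝ :=
  mulConvolution (mulConvolution (fun y => gammaKernel α y⁻¹) (gammaKernel m₂)) (gammaKernel m₁)

@[fun_prop]
theorem measurable_shadowingKernel (m₁ m₂ α : ℝ) : Measurable (shadowingKernel m₁ m₂ α) :=
  measurable_mulConvolution (measurable_mulConvolution (by fun_prop) (by fun_prop)) (by fun_prop)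

theorem shadowingKernel_eq_tricomiU {m₁ m₂ α z : ℝ} (h₁ : 0 < α + m₁) (h₂ : 0 < α + m₂)
    (hz : 0 < z) :
    shadowingKernel m₁ m₂ α z = Real.Gamma (α + m₁) * Real.Gamma (α + m₂) *
      (z ^ m₁ * tricomiU (α + m₁) (m₁ - m₂ + 1) z) := by
  have hintegrand : EqOn
      (fun t => t⁻¹ • (mulConvolution (fun y => gammaKernel α y⁻¹) (gammaKernel m₂) (z / (z * t)) *
        gammaKernel m₁ (z * t)))
      (fun t => Real.Gamma (α + m₂) * z ^ m₁ * (Real.exp (-(z * t)) * t ^ (α + m₁ - 1) *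
        (1 + t) ^ (m₁ - m₂ + 1 - (α + m₁) - 1))) (Ioi 0) := by
    intro t (ht : 0 < t)
    have hbetaPrime : mulConvolution (fun y => gammaKernel α y⁻¹) (gammaKernel m₂) (z / (z * t)) =
        Real.Gamma (α + m₂) * (t ^ α * (1 + t) ^ (-(α + m₂))) := by
      have hone : 1 + t⁻¹ = (1 + t) / t := by field_simp; ring
      rw [show z / (z * t) = t⁻¹ by field_simp,
        mulConvolution_gammaKernel_inv_gammaKernel h₂ (inv_pos.2 ht), hone,
        Real.div_rpow (by positivity) ht.le, Real.inv_rpow ht.le, Real.rpow_neg ht.le,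
        Real.rpow_add ht]
      field_simp
    simp only [smul_eq_mul, hbetaPrime]
    simp only [gammaKernel, Real.mul_rpow hz.le ht.le, Real.rpow_sub_one ht.ne',
      Real.rpow_add ht, show m₁ - m₂ + 1 - (α + m₁) - 1 = -(α + m₂) by ring]
    ring
  rw [shadowingKernel, mulConvolution_eq_integral_comp_mul _ _ z hz,
    setIntegral_congr_fun measurableSet_Ioi hintegrand, integral_const_mul, tricomiU]
  have := (Real.Gamma_pos_of_pos h₁).ne'
  field_simp

theorem integrableOn_tricomiU {a b z : ℝ} (ha : 0 < a) (hb : b ≤ a + 1) (hz : 0 < z) :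
    IntegrableOn (fun t : ℝ => Real.exp (-(z * t)) * t ^ (a - 1) * (1 + t) ^ (b - a - 1))
      (Ioi 0) := by
  have hgamma : IntegrableOn (fun t : ℝ => t ^ (a - 1) * Real.exp (-(z * t))) (Ioi 0) := by
    simpa using integrableOn_rpow_mul_exp_neg_mul_rpow (s := a - 1) (by linarith) one_pos hz
  refine hgamma.mono' (by fun_prop) ?_
  filter_upwards [ae_restrict_mem measurableSet_Ioi] with t ht
  rw [mem_Ioi] at ht
  rw [Real.norm_of_nonneg (by positivity), mul_comm (Real.exp _)]
  exact mul_le_of_le_one_right (by positivity)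
    (Real.rpow_le_one_of_one_le_of_nonpos (by linarith) (by linarith))

theorem tricomiU_pos {a b z : ℝ} (ha : 0 < a) (hb : b ≤ a + 1) (hz : 0 < z) :
    0 < tricomiU a b z := by
  have hpos : ∀ t ∈ Ioi (0 : ℝ),
      0 < Real.exp (-(z * t)) * t ^ (a - 1) * (1 + t) ^ (b - a - 1) := fun t (ht : 0 < t) => by
    positivity
  refine mul_pos (inv_pos.2 (Real.Gamma_pos_of_pos ha)) ?_
  refine (setIntegral_pos_iff_support_of_nonneg_ae
    ((ae_restrict_mem measurableSet_Ioi).mono fun t ht => (hpos t ht).le)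
    (integrableOn_tricomiU ha hb hz)).2 ?_
  refine (?_ : 0 < volume (Ioi (0 : ℝ))).trans_le (measure_mono fun t ht => ⟨(hpos t ht).ne', ht⟩)
  simp

theorem continuousAt_tricomiU {a b z : ℝ} (ha : 0 < a) (hb : b ≤ a + 1) (hz : 0 < z) :
    ContinuousAt (tricomiU a b) z := by
  refine continuousAt_const.mul (continuousAt_of_dominated
    (bound := fun t => Real.exp (-(z / 2 * t)) * t ^ (a - 1) * (1 + t) ^ (b - a - 1))
    (.of_forall fun x => by fun_prop) ?_
    (integrableOn_tricomiU ha hb (half_pos hz)) (.of_forall fun t => by fun_prop))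
  filter_upwards [lt_mem_nhds (half_lt_self hz)] with x hx
  filter_upwards [ae_restrict_mem measurableSet_Ioi] with t ht
  rw [mem_Ioi] at ht
  rw [Real.norm_of_nonneg (by positivity)]
  gcongr

theorem shadowingKernel_pos {m₁ m₂ α z : ℝ} (h₁ : 0 < α + m₁) (h₂ : 0 < α + m₂) (hz : 0 < z) :
    0 < shadowingKernel m₁ m₂ α z := by
  have hU := tricomiU_pos h₁ (b := m₁ - m₂ + 1) (by linarith) hz
  have := Real.Gamma_pos_of_pos h₁
  have := Real.Gamma_pos_of_pos h₂
  rw [shadowingKernel_eq_tricomiU h₁ h₂ hz]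
  positivity

theorem continuousAt_shadowingKernel {m₁ m₂ α z : ℝ} (h₁ : 0 < α + m₁) (h₂ : 0 < α + m₂)
    (hz : 0 < z) : ContinuousAt (shadowingKernel m₁ m₂ α) z := by
  have hU := continuousAt_tricomiU h₁ (b := m₁ - m₂ + 1) (by linarith) hz
  refine ((continuousAt_const (y := Real.Gamma (α + m₁) * Real.Gamma (α + m₂))).mul
    ((Real.continuousAt_rpow_const z m₁ (.inl hz.ne')).mul hU)).congr ?_
  filter_upwards [lt_mem_nhds hz] with x hx using (shadowingKernel_eq_tricomiU h₁ h₂ hx).symm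

theorem hasMellin_shadowingKernel {m₁ m₂ α : ℝ} {s : ℂ} (h₁ : 0 < m₁ + s.re) (h₂ : 0 < m₂ + s.re)
    (hα : s.re < α) :
    HasMellin (fun z => (shadowingKernel m₁ m₂ α z : ℂ)) s
      (Complex.Gamma (α - s) * Complex.Gamma (m₂ + s) * Complex.Gamma (m₁ + s)) := by
  have hM := hasMellin_mulConvolution (measurable_mulConvolution (by fun_prop) (by fun_prop))
    (by fun_prop) (hasMellin_mulConvolution (by fun_prop) (by fun_prop)
      (hasMellin_gammaKernel_inv hα) (hasMellin_gammaKernel h₂)) (hasMellin_gammaKernel h₁)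
  rwa [mulConvolution_ofReal (fun y => gammaKernel α y⁻¹), mulConvolution_ofReal] at hM

theorem hasMellin_one_ofReal {f : ℝ → ℝ} {M : ℝ} :
    HasMellin (fun x => (f x : ℂ)) 1 M ↔ IntegrableOn f (Ioi 0) ∧ ∫ x in Ioi 0, f x = M := by
  have hint : IntegrableOn (fun x => (f x : ℂ)) (Ioi 0) ↔ IntegrableOn f (Ioi 0) :=
    ⟨fun h => h.re, fun h => h.ofReal⟩
  simp only [HasMellin, MellinConvergent, mellin, sub_self, Complex.cpow_zero, one_smul, hint,
    integral_complex_ofReal, Complex.ofReal_inj]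

theorem hasMellin_one_shadowingKernel {m₁ m₂ α : ℝ} (h₁ : 0 < m₁ + 1) (h₂ : 0 < m₂ + 1)
    (hα : 1 < α) :
    HasMellin (fun z => (shadowingKernel m₁ m₂ α z : ℂ)) 1
      ((Real.Gamma (α - 1) * Real.Gamma (m₂ + 1) * Real.Gamma (m₁ + 1) : ℝ) : ℂ) := by
  push_cast [← Complex.Gamma_ofReal]
  exact hasMellin_shadowingKernel (by simpa) (by simpa) (by simpa)

theorem mellinBarnes_two_one_eq_shadowingKernel {m₁ m₂ α c z : ℝ} (hz : 0 < z)
    (hc : MeijerSeparates 2 1 ![1 - (α : ℂ)] ![(m₁ : ℂ), (m₂ : ℂ)] c) :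
    mellinBarnes 2 1 ![1 - (α : ℂ)] ![(m₁ : ℂ), (m₂ : ℂ)] c z = shadowingKernel m₁ m₂ α z := by
  obtain ⟨hα, h₁, h₂⟩ := meijerSeparates_two_one_iff.1 hc
  refine mellinBarnes_eq_of_hasMellin (f := fun z => (shadowingKernel m₁ m₂ α z : ℂ)) hz
    (Complex.continuous_ofReal.continuousAt.comp
      (continuousAt_shadowingKernel (by linarith) (by linarith) hz))
    (verticalIntegrable_meijerIntegrand_two_one hc) fun s hs => ?_
  convert! hasMellin_shadowingKernel (m₁ := m₁) (m₂ := m₂) (α := α) (s := s)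
    (by linarith) (by linarith) (by linarith) using 1
  rw [meijerIntegrand_two_one, Complex.one_cpow]
  ring_nf

theorem meijerG_two_one_eq_shadowingKernel {m₁ m₂ α z : ℝ} (h₁ : 0 < α + m₁) (h₂ : 0 < α + m₂)
    (hz : 0 < z) :
    meijerG 2 1 ![1 - (α : ℂ)] ![(m₁ : ℂ), (m₂ : ℂ)] z = shadowingKernel m₁ m₂ α z := by
  have hsep : ∃ c, MeijerSeparates 2 1 ![1 - (α : ℂ)] ![(m₁ : ℂ), (m₂ : ℂ)] c := by
    obtain ⟨c, hc, hc'⟩ := exists_between (lt_min (by linarith : -α < m₁) (by linarith : -α < m₂))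
    exact ⟨c, meijerSeparates_two_one_iff.2 ⟨hc, lt_min_iff.1 hc'⟩⟩
  rw [meijerG, dif_pos hsep, mellinBarnes_two_one_eq_shadowingKernel hz hsep.choose_spec]

/-! ### Densities of products of independent variables -/

theorem lintegral_comp_mul_left_Ioi {φ : ℝ → ENNReal} (hφ : Measurable φ) {y : ℝ} (hy : 0 < y) :
    ∫⁻ x in Ioi 0, φ (y * x) = ENNReal.ofReal y⁻¹ * ∫⁻ x in Ioi 0, φ x := by
  have hpre : (y * ·) ⁻¹' Ioi 0 = Ioi (0 : ℝ) := by
    ext x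
    simp [hy]
  have hmap : (volume.restrict (Ioi 0)).map (y * ·) =
      ENNReal.ofReal y⁻¹ • volume.restrict (Ioi (0 : ℝ)) := by
    rw [← Measure.restrict_smul, ← abs_of_pos (inv_pos.2 hy), ← Real.map_volume_mul_left hy.ne',
      Measure.restrict_map (by fun_prop) measurableSet_Ioi, hpre]
  rw [← lintegral_map hφ (measurable_const_mul y), hmap, lintegral_smul_measure, smul_eq_mul]

theorem densityMeasure_indicator {s : Set ℝ} (hs : MeasurableSet s) (f : ℝ → ℝ) :
    densityMeasure (s.indicator f) =
      (volume.restrict s).withDensity fun x => ENNReal.ofReal (f x) := by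
  rw [densityMeasure, ← withDensity_indicator hs]
  congr 1
  ext x
  by_cases hx : x ∈ s <;> simp [hx]

theorem ae_ofReal_mulConvolution_eq_lintegral {f g : ℝ → ℝ} (hfm : Measurable f)
    (hgm : Measurable g) (hf : IntegrableOn f (Ioi 0)) (hg : IntegrableOn g (Ioi 0))
    (hf0 : ∀ x, 0 < x → 0 ≤ f x) (hg0 : ∀ x, 0 < x → 0 ≤ g x) :
    ∀ᵐ z ∂volume.restrict (Ioi 0), ENNReal.ofReal (mulConvolution f g z) =
      ∫⁻ y in Ioi 0, ENNReal.ofReal y⁻¹ * (ENNReal.ofReal (f (z / y)) * ENNReal.ofReal (g y)) := by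
  filter_upwards [(integrable_mulConvolution_integrand hfm hgm hf hg).prod_left_ae,
    ae_restrict_mem measurableSet_Ioi] with z hint hz
  rw [mulConvolution, ofReal_integral_eq_lintegral_ofReal hint]
  · refine setLIntegral_congr_fun measurableSet_Ioi fun y (hy : 0 < y) => ?_
    rw [smul_eq_mul, ENNReal.ofReal_mul (inv_pos.2 hy).le,
      ENNReal.ofReal_mul (hf0 _ (div_pos hz hy))]
  · filter_upwards [ae_restrict_mem measurableSet_Ioi] with y hy
    exact smul_nonneg (inv_pos.2 hy).le (mul_nonneg (hf0 _ (div_pos hz hy)) (hg0 y hy))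

theorem mconv_withDensity_restrict_Ioi {f g : ℝ → ENNReal} (hf : Measurable f)
    (hg : Measurable g) :
    (volume.restrict (Ioi 0)).withDensity f ∗ₘ (volume.restrict (Ioi 0)).withDensity g =
      (volume.restrict (Ioi 0)).withDensity fun z =>
        ∫⁻ y in Ioi 0, ENNReal.ofReal y⁻¹ * (f (z / y) * g y) := by
  refine Measure.ext_of_lintegral _ fun φ hφ => ?_
  have hdens : Measurable fun z : ℝ => ∫⁻ y in Ioi 0, ENNReal.ofReal y⁻¹ * (f (z / y) * g y) :=
    Measurable.lintegral_prod_right (by fun_prop)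
  have hscale : ∀ y ∈ Ioi (0 : ℝ), ∫⁻ x in Ioi 0, f x * (g y * φ (x * y)) =
      ∫⁻ z in Ioi 0, ENNReal.ofReal y⁻¹ * (f (z / y) * g y) * φ z := fun y (hy : 0 < y) => by
    have h := lintegral_comp_mul_left_Ioi (φ := fun z => f (z / y) * (g y * φ z)) (by fun_prop) hy
    simp only [mul_div_cancel_left₀ _ hy.ne'] at h
    rw [← lintegral_const_mul _ (by fun_prop)] at h
    simpa only [mul_comm _ y, mul_assoc] using h
  calc ∫⁻ x, φ x ∂_ = ∫⁻ x in Ioi 0, f x * ∫⁻ y in Ioi 0, g y * φ (x * y) := by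
        rw [Measure.lintegral_mconv hφ, lintegral_withDensity_eq_lintegral_mul _ hf
          (Measurable.lintegral_prod_right (by fun_prop))]
        refine lintegral_congr fun x => ?_
        rw [Pi.mul_apply, lintegral_withDensity_eq_lintegral_mul _ hg (by fun_prop)]
        rfl
    _ = ∫⁻ y in Ioi 0, ∫⁻ x in Ioi 0, f x * (g y * φ (x * y)) := by
        rw [lintegral_lintegral_swap (by fun_prop)]
        exact lintegral_congr fun x => (lintegral_const_mul _ (by fun_prop)).symm
    _ = ∫⁻ y in Ioi 0, ∫⁻ z in Ioi 0, ENNReal.ofReal y⁻¹ * (f (z / y) * g y) * φ z :=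
        setLIntegral_congr_fun measurableSet_Ioi hscale
    _ = ∫⁻ z in Ioi 0, (∫⁻ y in Ioi 0, ENNReal.ofReal y⁻¹ * (f (z / y) * g y)) * φ z := by
        rw [lintegral_lintegral_swap (by fun_prop)]
        exact lintegral_congr fun z => lintegral_mul_const _ (by fun_prop)
    _ = _ := (lintegral_withDensity_eq_lintegral_mul _ hdens hφ).symm

section Laws

variable {S : Type*} [MeasurableSpace S] {P : Measure S} {X Y : S → ℝ} {f g : ℝ → ℝ}

theorem integrableOn_of_hasLaw_densityMeasure [IsFiniteMeasure P] (hfm : Measurable f) {s : Set ℝ}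
    (hs : MeasurableSet s) (hf0 : ∀ x ∈ s, 0 ≤ f x)
    (hX : HasLaw X (densityMeasure (s.indicator f)) P) : IntegrableOn f s := by
  have hfinite : IsFiniteMeasure (densityMeasure (s.indicator f)) := hX.isFiniteMeasure_iff.1 ‹_›
  rw [densityMeasure_indicator hs] at hfinite
  refine (lintegral_ofReal_ne_top_iff_integrable hfm.aestronglyMeasurable
    ((ae_restrict_mem hs).mono hf0)).1 ?_
  simpa using hfinite.measure_univ_lt_top.ne

theorem hasLaw_mul_mulConvolution [IsFiniteMeasure P] (hfm : Measurable f) (hgm : Measurable g)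
    (hf0 : ∀ x, 0 < x → 0 ≤ f x) (hg0 : ∀ x, 0 < x → 0 ≤ g x)
    (hX : HasLaw X (densityMeasure ((Ioi 0).indicator f)) P)
    (hY : HasLaw Y (densityMeasure ((Ioi 0).indicator g)) P) (hXY : IndepFun X Y P) :
    HasLaw (fun ω => X ω * Y ω) (densityMeasure ((Ioi 0).indicator (mulConvolution f g))) P := by
  have hf := integrableOn_of_hasLaw_densityMeasure hfm measurableSet_Ioi hf0 hX
  have hg := integrableOn_of_hasLaw_densityMeasure hgm measurableSet_Ioi hg0 hY
  have := hX.isFiniteMeasure_iff.1 ‹_›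
  have := hY.isFiniteMeasure_iff.1 ‹_›
  have hmul := hXY.hasLaw_fun_mul hX hY
  rwa [densityMeasure_indicator measurableSet_Ioi f, densityMeasure_indicator measurableSet_Ioi g,
    mconv_withDensity_restrict_Ioi (by fun_prop) (by fun_prop),
    ← withDensity_congr_ae (ae_ofReal_mulConvolution_eq_lintegral hfm hgm hf hg hf0 hg0),
    ← densityMeasure_indicator measurableSet_Ioi] at hmul

theorem integrable_of_hasLaw_densityMeasure (hfm : Measurable f) {s : Set ℝ}
    (hs : MeasurableSet s) (hf0 : ∀ x ∈ s, 0 ≤ f x)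
    (hX : HasLaw X (densityMeasure (s.indicator f)) P)
    (hint : IntegrableOn (fun x => x * f x) s) : Integrable X P := by
  rw [densityMeasure_indicator hs] at hX
  have hid : Integrable id ((volume.restrict s).withDensity fun x => ENNReal.ofReal (f x)) := by
    refine (integrable_withDensity_iff (by fun_prop) (by simp)).2
      (hint.congr_fun (fun x hx => ?_) hs)
    simp only [id, ENNReal.toReal_ofReal (hf0 x hx)]
  rw [← hX.map_eq] at hid
  exact hid.comp_aemeasurable hX.aemeasurable

theorem integral_of_hasLaw_densityMeasure (hfm : Measurable f) {s : Set ℝ}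
    (hs : MeasurableSet s) (hf0 : ∀ x ∈ s, 0 ≤ f x)
    (hX : HasLaw X (densityMeasure (s.indicator f)) P) :
    ∫ ω, X ω ∂P = ∫ x in s, x * f x := by
  rw [densityMeasure_indicator hs] at hX
  rw [hX.integral_eq, integral_withDensity_eq_integral_toReal_smul (by fun_prop) (by simp)]
  refine setIntegral_congr_fun hs fun x hx => ?_
  simp only [ENNReal.toReal_ofReal (hf0 x hx), smul_eq_mul, mul_comm]

end Laws

/-- The density on `(0, ∞)` of a random variable whose density with respect to `dx / x` is
`x ↦ c F(k x)`.  Products of independent variables multiply the constants `c` and the scales `k`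
and convolve the profiles `F` multiplicatively. -/
noncomputable def mulHaarPDF (c k : ℝ) (F : ℝ → ℝ) : ℝ → ℝ :=
  (Ioi 0).indicator fun x => x⁻¹ * (c * F (k * x))

theorem mulHaarPDF_of_pos (c k : ℝ) (F : ℝ → ℝ) {x : ℝ} (hx : 0 < x) :
    mulHaarPDF c k F x = x⁻¹ * (c * F (k * x)) :=
  indicator_of_mem (mem_Ioi.2 hx) _

theorem mulHaarPDF_of_nonpos (c k : ℝ) (F : ℝ → ℝ) {x : ℝ} (hx : x ≤ 0) :
    mulHaarPDF c k F x = 0 :=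
  indicator_of_notMem (notMem_Ioi.2 hx) _

theorem nakagamiSqPDF_eq_mulHaarPDF {m Ω : ℝ} (hm : 0 ≤ m) (hΩ : 0 < Ω) :
    nakagamiSqPDF m Ω = mulHaarPDF (Real.Gamma m)⁻¹ (m / Ω) (gammaKernel m) := by
  ext x
  rcases le_or_gt x 0 with hx | hx
  · rw [mulHaarPDF_of_nonpos _ _ _ hx, nakagamiSqPDF, if_neg hx.not_gt]
  · have hscale : m / Ω * x = m * x / Ω := div_mul_eq_mul_div m Ω x
    rw [mulHaarPDF_of_pos _ _ _ hx, nakagamiSqPDF, if_pos hx, gammaKernel, hscale,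
      Real.div_rpow (by positivity) hΩ.le, Real.mul_rpow hm hx.le, Real.rpow_sub_one hx.ne']
    field_simp

theorem invGammaPDF_eq_mulHaarPDF {α θ : ℝ} (hθ : 0 ≤ θ) :
    invGammaPDF α θ = mulHaarPDF (Real.Gamma α)⁻¹ θ⁻¹ (fun y => gammaKernel α y⁻¹) := by
  ext y
  rcases le_or_gt y 0 with hy | hy
  · rw [mulHaarPDF_of_nonpos _ _ _ hy, invGammaPDF, if_neg hy.not_gt]
  · have hinv : (θ⁻¹ * y)⁻¹ = θ / y := by rw [mul_inv, inv_inv, div_eq_mul_inv]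
    rw [mulHaarPDF_of_pos _ _ _ hy, invGammaPDF, if_pos hy, gammaKernel, hinv,
      Real.div_rpow hθ hy.le, Real.rpow_add_one hy.ne']
    field_simp

section MulHaarLaws

variable {S : Type*} [MeasurableSpace S] {P : Measure S} {X Y : S → ℝ} {c d k l : ℝ}
  {F G : ℝ → ℝ}

theorem hasLaw_mul_mulHaarPDF [IsFiniteMeasure P] (hF : Measurable F) (hG : Measurable G)
    (hF0 : ∀ x, 0 < x → 0 ≤ F x) (hG0 : ∀ x, 0 < x → 0 ≤ G x) (hc : 0 ≤ c) (hd : 0 ≤ d)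
    (hk : 0 < k) (hl : 0 < l) (hX : HasLaw X (densityMeasure (mulHaarPDF c k F)) P)
    (hY : HasLaw Y (densityMeasure (mulHaarPDF d l G)) P) (hXY : IndepFun X Y P) :
    HasLaw (fun ω => X ω * Y ω)
      (densityMeasure (mulHaarPDF (c * d) (k * l) (mulConvolution F G))) P := by
  have hf0 : ∀ x, 0 < x → 0 ≤ x⁻¹ * (c * F (k * x)) := fun x hx =>
    mul_nonneg (inv_pos.2 hx).le (mul_nonneg hc (hF0 _ (mul_pos hk hx)))
  have hg0 : ∀ x, 0 < x → 0 ≤ x⁻¹ * (d * G (l * x)) := fun x hx =>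
    mul_nonneg (inv_pos.2 hx).le (mul_nonneg hd (hG0 _ (mul_pos hl hx)))
  convert! hasLaw_mul_mulConvolution (by fun_prop) (by fun_prop) hf0 hg0 hX hY hXY using 2
  refine indicator_congr fun z hz => ?_
  rw [mulConvolution_mul_of_multiplicative (fun x y _ _ => mul_inv x y)
    (fun x => c * F (k * x)) _ hz, mulConvolution_const_mul_comp_mul c d F G k hl]

theorem integrable_of_hasLaw_mulHaarPDF (hF : Measurable F) (hF0 : ∀ x, 0 < x → 0 ≤ F x)
    (hc : 0 ≤ c) (hk : 0 < k) (hX : HasLaw X (densityMeasure (mulHaarPDF c k F)) P)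
    (hint : IntegrableOn F (Ioi 0)) : Integrable X P := by
  refine integrable_of_hasLaw_densityMeasure (by fun_prop) measurableSet_Ioi
    (fun x hx => mul_nonneg (inv_pos.2 hx).le (mul_nonneg hc (hF0 _ (mul_pos hk hx)))) hX ?_
  have hscaled : IntegrableOn (fun x => F (k * x)) (Ioi 0) :=
    (integrableOn_Ioi_comp_mul_left_iff F 0 hk).2 (by rwa [mul_zero])
  refine IntegrableOn.congr_fun (hscaled.const_mul c) (fun x (hx : 0 < x) => ?_) measurableSet_Ioi
  simp only [mul_inv_cancel_left₀ hx.ne']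

theorem integral_of_hasLaw_mulHaarPDF (hF : Measurable F) (hF0 : ∀ x, 0 < x → 0 ≤ F x)
    (hc : 0 ≤ c) (hk : 0 < k) (hX : HasLaw X (densityMeasure (mulHaarPDF c k F)) P) :
    ∫ ω, X ω ∂P = c * (k⁻¹ * ∫ x in Ioi 0, F x) := by
  rw [integral_of_hasLaw_densityMeasure (by fun_prop) measurableSet_Ioi
    (fun x hx => mul_nonneg (inv_pos.2 hx).le (mul_nonneg hc (hF0 _ (mul_pos hk hx)))) hX]
  have hsub := integral_comp_mul_left_Ioi F 0 hk
  rw [mul_zero, smul_eq_mul] at hsub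
  rw [← hsub, ← integral_const_mul]
  refine setIntegral_congr_fun measurableSet_Ioi fun x (hx : 0 < x) => ?_
  simp only [mul_inv_cancel_left₀ hx.ne']

end MulHaarLaws

/-- The density of `Y₁ Y₂ / (k Z)` for independent standard Gamma variables `Y₁`, `Y₂`, `Z` with
shapes `m₁`, `m₂`, `α`: the law of the single-shadowing SNR, where `k` is the paper's `γ̃`. -/
noncomputable def singleShadowingPDF (m₁ m₂ α k : ℝ) : ℝ → ℝ :=
  mulHaarPDF (1 / (Real.Gamma m₁ * Real.Gamma m₂ * Real.Gamma α)) k (shadowingKernel m₁ m₂ α)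

section SingleShadowing

variable {m₁ m₂ α : ℝ}

theorem one_div_gamma_mul_gamma_mul_gamma_pos (hm₁ : 0 < m₁) (hm₂ : 0 < m₂) (hα : 0 < α) :
    0 < 1 / (Real.Gamma m₁ * Real.Gamma m₂ * Real.Gamma α) :=
  one_div_pos.2 (mul_pos (mul_pos (Real.Gamma_pos_of_pos hm₁) (Real.Gamma_pos_of_pos hm₂))
    (Real.Gamma_pos_of_pos hα))

theorem singleShadowingPDF_of_nonpos (k : ℝ) {γ : ℝ} (hγ : γ ≤ 0) :
    singleShadowingPDF m₁ m₂ α k γ = 0 :=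
  mulHaarPDF_of_nonpos _ _ _ hγ

theorem singleShadowingPDF_pos (hm₁ : 0 < m₁) (hm₂ : 0 < m₂) (hα : 0 < α) {k γ : ℝ} (hk : 0 < k)
    (hγ : 0 < γ) : 0 < singleShadowingPDF m₁ m₂ α k γ := by
  have := one_div_gamma_mul_gamma_mul_gamma_pos hm₁ hm₂ hα
  have hkernel := shadowingKernel_pos (add_pos hα hm₁) (add_pos hα hm₂) (mul_pos hk hγ)
  rw [singleShadowingPDF, mulHaarPDF_of_pos _ _ _ hγ]
  positivity

theorem singleShadowingPDF_eq_meijerG (h₁ : 0 < α + m₁) (h₂ : 0 < α + m₂) {k γ : ℝ} (hk : 0 < k)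
    (hγ : 0 < γ) :
    (singleShadowingPDF m₁ m₂ α k γ : ℂ) =
      ((1 / (Real.Gamma m₁ * Real.Gamma m₂ * Real.Gamma α) : ℝ) : ℂ) * (γ : ℂ)⁻¹ *
        meijerG 2 1 ![1 - (α : ℂ)] ![(m₁ : ℂ), (m₂ : ℂ)] ((k * γ : ℝ) : ℂ) := by
  rw [singleShadowingPDF, mulHaarPDF_of_pos _ _ _ hγ,
    meijerG_two_one_eq_shadowingKernel h₁ h₂ (mul_pos hk hγ)]
  push_cast
  ring

theorem singleShadowingPDF_eq_tricomiU (h₁ : 0 < α + m₁) (h₂ : 0 < α + m₂) {k γ : ℝ} (hk : 0 < k)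
    (hγ : 0 < γ) :
    singleShadowingPDF m₁ m₂ α k γ = Real.Gamma (α + m₁) * Real.Gamma (α + m₂) *
      (1 / (Real.Gamma m₁ * Real.Gamma m₂ * Real.Gamma α)) * k ^ m₁ * γ ^ (m₁ - 1) *
        tricomiU (α + m₁) (m₁ - m₂ + 1) (k * γ) := by
  rw [singleShadowingPDF, mulHaarPDF_of_pos _ _ _ hγ,
    shadowingKernel_eq_tricomiU h₁ h₂ (mul_pos hk hγ), Real.mul_rpow hk.le hγ.le,
    Real.rpow_sub_one hγ.ne']
  ring

variable {S : Type*} [MeasurableSpace S] {P : Measure S}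

theorem integrable_of_hasLaw_singleShadowingPDF (hm₁ : 0 < m₁) (hm₂ : 0 < m₂) (hα : 1 < α) {k : ℝ}
    (hk : 0 < k) {X : S → ℝ} (hX : HasLaw X (densityMeasure (singleShadowingPDF m₁ m₂ α k)) P) :
    Integrable X P :=
  integrable_of_hasLaw_mulHaarPDF (by fun_prop)
    (fun x hx => (shadowingKernel_pos (by linarith) (by linarith) hx).le)
    (one_div_gamma_mul_gamma_mul_gamma_pos hm₁ hm₂ (by linarith)).le hk hX
    (hasMellin_one_ofReal.1 (hasMellin_one_shadowingKernel (by linarith) (by linarith) hα)).1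

theorem integral_of_hasLaw_singleShadowingPDF (hm₁ : 0 < m₁) (hm₂ : 0 < m₂) (hα : 1 < α) {k : ℝ}
    (hk : 0 < k) {X : S → ℝ} (hX : HasLaw X (densityMeasure (singleShadowingPDF m₁ m₂ α k)) P) :
    ∫ ω, X ω ∂P = m₁ * m₂ / k / (α - 1) := by
  have hα1 : 0 < α - 1 := sub_pos.2 hα
  have hΓα : Real.Gamma α = (α - 1) * Real.Gamma (α - 1) := by
    rw [← Real.Gamma_add_one hα1.ne', sub_add_cancel]
  have := Real.Gamma_pos_of_pos hα1
  have := Real.Gamma_pos_of_pos hm₁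
  have := Real.Gamma_pos_of_pos hm₂
  rw [integral_of_hasLaw_mulHaarPDF (by fun_prop)
    (fun x hx => (shadowingKernel_pos (by linarith) (by linarith) hx).le)
    (one_div_gamma_mul_gamma_mul_gamma_pos hm₁ hm₂ (by linarith)).le hk hX,
    (hasMellin_one_ofReal.1 (hasMellin_one_shadowingKernel (by linarith) (by linarith) hα)).2,
    Real.Gamma_add_one hm₁.ne', Real.Gamma_add_one hm₂.ne', hΓα]
  field_simp

theorem hasLaw_singleShadowing {Ω₁ Ω₂ θ : ℝ} {A₁ A₂ I : S → ℝ} (hm₁ : 0 < m₁) (hm₂ : 0 < m₂)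
    (hα : 0 < α) (hΩ₁ : 0 < Ω₁) (hΩ₂ : 0 < Ω₂) (hθ : 0 < θ) (hindep : iIndepFun ![A₁, A₂, I] P)
    (hA₁ : HasLaw A₁ (densityMeasure (nakagamiSqPDF m₁ Ω₁)) P)
    (hA₂ : HasLaw A₂ (densityMeasure (nakagamiSqPDF m₂ Ω₂)) P)
    (hI : HasLaw I (densityMeasure (invGammaPDF α θ)) P) :
    HasLaw (fun ω => I ω * A₂ ω * A₁ ω)
      (densityMeasure (singleShadowingPDF m₁ m₂ α (m₁ * m₂ / (Ω₁ * Ω₂ * θ)))) P := by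
  have := hindep.isProbabilityMeasure
  have hmeas : ∀ i, AEMeasurable (![A₁, A₂, I] i) P := fun i => by
    fin_cases i
    exacts [hA₁.aemeasurable, hA₂.aemeasurable, hI.aemeasurable]
  have hΓ₁ := Real.Gamma_pos_of_pos hm₁
  have hΓ₂ := Real.Gamma_pos_of_pos hm₂
  have hΓ := Real.Gamma_pos_of_pos hα
  have hinv : ∀ x, 0 < x → 0 ≤ gammaKernel α x⁻¹ :=
    fun x hx => gammaKernel_nonneg α (inv_pos.2 hx).le
  have hker : ∀ m x, 0 < x → 0 ≤ gammaKernel m x := fun m x hx => gammaKernel_nonneg m hx.le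
  rw [nakagamiSqPDF_eq_mulHaarPDF hm₁.le hΩ₁] at hA₁
  rw [nakagamiSqPDF_eq_mulHaarPDF hm₂.le hΩ₂] at hA₂
  rw [invGammaPDF_eq_mulHaarPDF hθ.le] at hI
  have hIA₂ := hasLaw_mul_mulHaarPDF (by fun_prop) (by fun_prop) hinv (hker m₂) (by positivity)
    (by positivity) (by positivity) (by positivity) hI hA₂
    (hindep.indepFun (i := 2) (j := 1) (by decide))
  have hIA₂A₁ := hasLaw_mul_mulHaarPDF (measurable_mulConvolution (by fun_prop) (by fun_prop))
    (by fun_prop) (fun x hx => mulConvolution_nonneg hinv (hker m₂) hx) (hker m₁) (by positivity)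
    (by positivity) (by positivity) (by positivity) hIA₂ hA₁
    (hindep.indepFun_mul_left₀ hmeas 2 1 0 (by decide) (by decide))
  have hconst : (Real.Gamma α)⁻¹ * (Real.Gamma m₂)⁻¹ * (Real.Gamma m₁)⁻¹ =
      1 / (Real.Gamma m₁ * Real.Gamma m₂ * Real.Gamma α) := by field_simp
  have hscale : θ⁻¹ * (m₂ / Ω₂) * (m₁ / Ω₁) = m₁ * m₂ / (Ω₁ * Ω₂ * θ) := by field_simp
  rw [hconst, hscale] at hIA₂A₁
  exact hIA₂A₁

end SingleShadowing

theorem iIndepFun_sq_sq_id {S : Type*} [MeasurableSpace S] {P : Measure S} {X Y Z : S → ℝ}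
    (h : iIndepFun ![X, Y, Z] P) :
    iIndepFun ![fun ω => X ω ^ 2, fun ω => Y ω ^ 2, Z] P := by
  have hcomp := h.comp ![fun x => x ^ 2, fun x => x ^ 2, id] fun i => by
    fin_cases i
    exacts [measurable_id.pow_const 2, measurable_id.pow_const 2, measurable_id]
  convert! hcomp using 1
  ext i ω
  fin_cases i <;> rfl

theorem mainTheorem3_general {S : Type*} [MeasurableSpace S] (P : Measure S)
    (m₁ m₂ α Ω₁ Ω₂ θ γbar γtilde S₂ : ℝ)
    (hm₁ : 0 < m₁) (hm₂ : 0 < m₂) (hα : 0 < α) (hΩ₁ : 0 < Ω₁) (hΩ₂ : 0 < Ω₂) (hθ : 0 < θ)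
    (hγbar : γbar = Ω₁ * Ω₂ * θ) (hγtilde : γtilde = m₁ * m₂ / γbar)
    (hS₂ : S₂ = 1 / (Real.Gamma m₁ * Real.Gamma m₂ * Real.Gamma α))
    (N₁ N₂ I : S → ℝ) (hindep : iIndepFun ![N₁, N₂, I] P)
    (hN₁ : HasLaw (fun ω => N₁ ω ^ 2) (densityMeasure (nakagamiSqPDF m₁ Ω₁)) P)
    (hN₂ : HasLaw (fun ω => N₂ ω ^ 2) (densityMeasure (nakagamiSqPDF m₂ Ω₂)) P)
    (hI : HasLaw I (densityMeasure (invGammaPDF α θ)) P) :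
    (∀ γ : ℝ, 0 < γ → ∀ c : ℝ, -α < c → c < m₁ → c < m₂ →
      Integrable (fun t : ℝ => meijerIntegrand 2 1 ![1 - (α : ℂ)] ![(m₁ : ℂ), (m₂ : ℂ)]
        ((γtilde * γ : ℝ) : ℂ) ((c : ℂ) + (t : ℂ) * Complex.I)) ∧
      mellinBarnes 2 1 ![1 - (α : ℂ)] ![(m₁ : ℂ), (m₂ : ℂ)] c ((γtilde * γ : ℝ) : ℂ) =
        meijerG 2 1 ![1 - (α : ℂ)] ![(m₁ : ℂ), (m₂ : ℂ)] ((γtilde * γ : ℝ) : ℂ)) ∧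
    (∃ f : ℝ → ℝ,
      (∀ γ : ℝ, γ ≤ 0 → f γ = 0) ∧
      (∀ γ : ℝ, 0 < γ →
        0 < f γ ∧
        (f γ : ℂ) = (S₂ : ℂ) * (γ : ℂ)⁻¹ *
          meijerG 2 1 ![1 - (α : ℂ)] ![(m₁ : ℂ), (m₂ : ℂ)] ((γtilde * γ : ℝ) : ℂ) ∧
        f γ = Real.Gamma (α + m₁) * Real.Gamma (α + m₂) * S₂ * γtilde ^ m₁ * γ ^ (m₁ - 1) *
          tricomiU (α + m₁) (m₁ - m₂ + 1) (γtilde * γ)) ∧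
      HasLaw (fun ω => (N₁ ω * N₂ ω) ^ 2 * I ω) (densityMeasure f) P) ∧
    (1 < α → Integrable (fun ω => (N₁ ω * N₂ ω) ^ 2 * I ω) P ∧
      ∫ ω, (N₁ ω * N₂ ω) ^ 2 * I ω ∂P = γbar / (α - 1)) := by
  subst hγtilde hS₂ hγbar
  have h₁ : 0 < α + m₁ := by positivity
  have h₂ : 0 < α + m₂ := by positivity
  have hk : 0 < m₁ * m₂ / (Ω₁ * Ω₂ * θ) := by positivity
  have hlaw : HasLaw (fun ω => (N₁ ω * N₂ ω) ^ 2 * I ω)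
      (densityMeasure (singleShadowingPDF m₁ m₂ α (m₁ * m₂ / (Ω₁ * Ω₂ * θ)))) P := by
    convert! hasLaw_singleShadowing hm₁ hm₂ hα hΩ₁ hΩ₂ hθ (iIndepFun_sq_sq_id hindep) hN₁ hN₂ hI
      using 2 with ω
    ring
  refine ⟨fun γ hγ c hc hc₁ hc₂ => ?_, ⟨singleShadowingPDF m₁ m₂ α _,
    fun γ => singleShadowingPDF_of_nonpos _, fun γ hγ => ⟨singleShadowingPDF_pos hm₁ hm₂ hα hk hγ,
      singleShadowingPDF_eq_meijerG h₁ h₂ hk hγ, singleShadowingPDF_eq_tricomiU h₁ h₂ hk hγ⟩,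
    hlaw⟩, fun hα1 => ⟨integrable_of_hasLaw_singleShadowingPDF hm₁ hm₂ hα1 hk hlaw, ?_⟩⟩
  · have hsep := meijerSeparates_two_one_iff.2 ⟨hc, hc₁, hc₂⟩
    have hz := mul_pos hk hγ
    exact ⟨verticalIntegrable_meijerIntegrand hz (verticalIntegrable_meijerIntegrand_two_one hsep),
      (mellinBarnes_two_one_eq_shadowingKernel hz hsep).trans
        (meijerG_two_one_eq_shadowingKernel h₁ h₂ hz).symm⟩
  · rw [integral_of_hasLaw_singleShadowingPDF hm₁ hm₂ hα1 hk hlaw]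
    field_simp

theorem mainTheorem3 {S : Type*} [MeasurableSpace S] (P : Measure S) [IsProbabilityMeasure P]
    (m₁ m₂ α Ω θ γbar γtilde S₂ : ℝ)
    (hm₁ : 0 < m₁) (hm₂ : 0 < m₂) (hα : 1 < α) (hΩ : 0 < Ω) (hθ : 0 < θ)
    (hγbar : γbar = Ω ^ 2 * θ) (hγtilde : γtilde = m₁ * m₂ / γbar)
    (hS₂ : S₂ = 1 / (Real.Gamma m₁ * Real.Gamma m₂ * Real.Gamma α))
    (N₁ N₂ I : S → ℝ) (hN₁m : Measurable N₁) (hN₂m : Measurable N₂) (hIm : Measurable I)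
    (hindep : iIndepFun ![N₁, N₂, I] P)
    (hN₁ : HasLaw (fun ω => N₁ ω ^ 2) (densityMeasure (nakagamiSqPDF m₁ Ω)) P)
    (hN₂ : HasLaw (fun ω => N₂ ω ^ 2) (densityMeasure (nakagamiSqPDF m₂ Ω)) P)
    (hI : HasLaw I (densityMeasure (invGammaPDF α θ)) P) :
    (∀ γ : ℝ, 0 < γ → ∀ c : ℝ, -α < c → c < m₁ → c < m₂ →
      Integrable (fun t : ℝ => meijerIntegrand 2 1 ![1 - (α : ℂ)] ![(m₁ : ℂ), (m₂ : ℂ)]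
        ((γtilde * γ : ℝ) : ℂ) ((c : ℂ) + (t : ℂ) * Complex.I)) ∧
      mellinBarnes 2 1 ![1 - (α : ℂ)] ![(m₁ : ℂ), (m₂ : ℂ)] c ((γtilde * γ : ℝ) : ℂ) =
        meijerG 2 1 ![1 - (α : ℂ)] ![(m₁ : ℂ), (m₂ : ℂ)] ((γtilde * γ : ℝ) : ℂ)) ∧
    (∃ f : ℝ → ℝ,
      (∀ γ : ℝ, γ ≤ 0 → f γ = 0) ∧
      (∀ γ : ℝ, 0 < γ →
        0 < f γ ∧
        (f γ : ℂ) = (S₂ : ℂ) * (γ : ℂ)⁻¹ *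
          meijerG 2 1 ![1 - (α : ℂ)] ![(m₁ : ℂ), (m₂ : ℂ)] ((γtilde * γ : ℝ) : ℂ) ∧
        f γ = Real.Gamma (α + m₁) * Real.Gamma (α + m₂) * S₂ * γtilde ^ m₁ * γ ^ (m₁ - 1) *
          tricomiU (α + m₁) (m₁ - m₂ + 1) (γtilde * γ)) ∧
      HasLaw (fun ω => (N₁ ω * N₂ ω) ^ 2 * I ω) (densityMeasure f) P) ∧
    Integrable (fun ω => (N₁ ω * N₂ ω) ^ 2 * I ω) P ∧
    ∫ ω, (N₁ ω * N₂ ω) ^ 2 * I ω ∂P = γbar / (α - 1) := by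
  obtain ⟨hmeijer, hdensity, hmean⟩ := mainTheorem3_general P m₁ m₂ α Ω Ω θ γbar γtilde S₂ hm₁ hm₂
    (one_pos.trans hα) hΩ hΩ hθ (by rw [hγbar, sq]) hγtilde hS₂ N₁ N₂ I hindep hN₁ hN₂ hI
  exact ⟨hmeijer, hdensity, hmean hα⟩
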